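/- Let $n,m,r\ge 0$ be integers and let $A,Q\in\mathbb{R}^{n\times n}$, $B,L\in\mathbb{R}^{n\times m}$, $R\in\mathbb{R}^{m\times m}$, $A_0^i\in\mathbb{R}^{n\times n}$, $B_0^i\in\mathbb{R}^{n\times m}$ ($i=1,\dots,r$), where $Q$ is symmetric and $R$ is symmetric positive definite. Inequalities between symmetric matrices are in the Loewner order, and a real square matrix is called stable if all its (complex) eigenvalues have negative real part. For symmetric $X\in\mathbb{R}^{n\times n}$ put \[ \Pi_{11}(X)=\sum_{i=1}^r A_0^{i\top}XA_0^i,\qquad \Pi_{12}(X)=\sum_{i=1}^r A_0^{i\top}XB_0^i,\qquad \Pi_{22}(X)=\sum_{i=1}^r B_0^{i\top}XB_0^i, \] \[ L_c(X)=L+\Pi_{12}(X),\qquad R_c(X)=R+\Pi_{22}(X),\qquad Q_c(X)=Q+\Pi_{11}(X), \] \[ A_c(X)=A-BR_c(X)^{-1}L_c(X)^\top,\qquad G_c(X)=BR_c(X)^{-1}B^\top,\qquad H_c(X)=Q_c(X)-L_c(X)R_c(X)^{-1}L_c(X)^\top, \] \[ \mathcal{R}(X)=A_c(X)^\top X+XA_c(X)-XG_c(X)X+H_c(X).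 \] The SCARE (stochastic continuous-time algebraic Riccati equation) is \[ A^\top X+XA+Q+\Pi_{11}(X)-(XB+L+\Pi_{12}(X))(R+\Pi_{22}(X))^{-1}(XB+L+\Pi_{12}(X))^\top=0 . \] Let $\widehat X\ge 0$ be a solution of the SCARE. Let $(X_k)_{k\ge 0}$ be a sequence generated by the fixed-point iteration FP-CARE_SDA, that is, for every $k\ge0$, with $A_k=A_c(X_k)$, $G_k=G_c(X_k)$, $H_k=H_c(X_k)$, the matrix $X_{k+1}$ is the stabilizing solution of \[ A_k^\top X+XA_k-XG_kX+H_k=0, \] i.e. $X_{k+1}$ is symmetric, solves this equation, and $A_k-G_kX_{k+1}$ is stable. Suppose that $X_0\ge\widehat X$, that $A_0-G_0X_0$ is stable, where $A_0=A_c(X_0)$ and $G_0=G_c(X_0)$, and that $\mathcal{R}(X_0)\le 0$. Then: (i) $X_k\ge X_{k+1}$, $X_k\ge\widehat X$ and $\mathcal{R}(X_k)\le 0$ for every $k\ge 0$; (ii) the limit $\lim_{k\to\infty}X_k=\widehat X_+$ exists, $\widehat X_+\ge\widehat X\ge 0$ (so $\widehat X_+$ is positive semidefinite), and $\widehat X_+$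 is a solution of the SCARE; (iii) every eigenvalue of $A_c(\widehat X_+)-G_c(\widehat X_+)\widehat X_+$ has real part $\le 0$. -/

import Mathlib

open scoped MatrixOrder Matrix

/-- Real coefficient matrices of a stochastic continuous-time algebraic Riccati equation:
state dimension `n`, input dimension `m`, `r` multiplicative noise channels with state and
input matrices `A0 i` and `B0 i`. -/
structure SCAREData (n m r : ℕ) where
  A : Matrix (Fin n) (Fin n) ℝ
  B : Matrix (Fin n) (Fin m) ℝ
  A0 : Fin r → Matrix (Fin n) (Fin n) ℝ
  B0 : Fin r → Matrix (Fin n) (Fin m) ℝ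
  Q : Matrix (Fin n) (Fin n) ℝ
  L : Matrix (Fin n) (Fin m) ℝ
  R : Matrix (Fin m) (Fin m) ℝ

/-- A real square matrix is stable (Hurwitz) if all its complex eigenvalues have negative
real part. -/
def IsStableMatrix {n : ℕ} (M : Matrix (Fin n) (Fin n) ℝ) : Prop :=
  ∀ z ∈ spectrum ℂ (M.map ((↑) : ℝ → ℂ)), z.re < 0

/-- `X` is a stabilizing solution of the algebraic Riccati equation
`Aᵀ X + X A - X G X + H = 0`: a symmetric solution with `A - G X` stable. -/
def IsStabilizingCARESolution {n : ℕ} (A G H X : Matrix (Fin n) (Fin n) ℝ) : Prop :=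
  X.IsSymm ∧ Aᵀ * X + X * A - X * G * X + H = 0 ∧ IsStableMatrix (A - G * X)

namespace SCAREData

variable {n m r : ℕ} (S : SCAREData n m r)

/-- `Π₁₁(X) = ∑ᵢ A₀ⁱᵀ X A₀ⁱ`. -/
def Pi11 (X : Matrix (Fin n) (Fin n) ℝ) : Matrix (Fin n) (Fin n) ℝ :=
  ∑ i, (S.A0 i)ᵀ * X * S.A0 i

/-- `Π₁₂(X) = ∑ᵢ A₀ⁱᵀ X B₀ⁱ`. -/
def Pi12 (X : Matrix (Fin n) (Fin n) ℝ) : Matrix (Fin n) (Fin m) ℝ :=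
  ∑ i, (S.A0 i)ᵀ * X * S.B0 i

/-- `Π₂₂(X) = ∑ᵢ B₀ⁱᵀ X B₀ⁱ`. -/
def Pi22 (X : Matrix (Fin n) (Fin n) ℝ) : Matrix (Fin m) (Fin m) ℝ :=
  ∑ i, (S.B0 i)ᵀ * X * S.B0 i

/-- `X` satisfies the stochastic continuous-time algebraic Riccati equation. -/
def IsSolution (X : Matrix (Fin n) (Fin n) ℝ) : Prop :=
  S.Aᵀ * X + X * S.A + S.Q + S.Pi11 X
    - (X * S.B + S.L + S.Pi12 X) * (S.R + S.Pi22 X)⁻¹ * (X * S.B + S.L + S.Pi12 X)ᵀ = 0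

/-- `L_c(X) = L + Π₁₂(X)`. -/
def Lc (X : Matrix (Fin n) (Fin n) ℝ) : Matrix (Fin n) (Fin m) ℝ := S.L + S.Pi12 X

/-- `R_c(X) = R + Π₂₂(X)`. -/
def Rc (X : Matrix (Fin n) (Fin n) ℝ) : Matrix (Fin m) (Fin m) ℝ := S.R + S.Pi22 X

/-- `Q_c(X) = Q + Π₁₁(X)`. -/
def Qc (X : Matrix (Fin n) (Fin n) ℝ) : Matrix (Fin n) (Fin n) ℝ := S.Q + S.Pi11 X

/-- `A_c(X) = A - B R_c(X)⁻¹ L_c(X)ᵀ`. -/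
noncomputable def Ac (X : Matrix (Fin n) (Fin n) ℝ) : Matrix (Fin n) (Fin n) ℝ :=
  S.A - S.B * (S.Rc X)⁻¹ * (S.Lc X)ᵀ

/-- `G_c(X) = B R_c(X)⁻¹ Bᵀ`. -/
noncomputable def Gc (X : Matrix (Fin n) (Fin n) ℝ) : Matrix (Fin n) (Fin n) ℝ :=
  S.B * (S.Rc X)⁻¹ * S.Bᵀ

/-- `H_c(X) = Q_c(X) - L_c(X) R_c(X)⁻¹ L_c(X)ᵀ`. -/
noncomputable def Hc (X : Matrix (Fin n) (Fin n) ℝ) : Matrix (Fin n) (Fin n) ℝ :=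
  S.Qc X - S.Lc X * (S.Rc X)⁻¹ * (S.Lc X)ᵀ

/-- The Riccati residual `𝓡(X) = A_c(X)ᵀ X + X A_c(X) - X G_c(X) X + H_c(X)`. -/
noncomputable def residual (X : Matrix (Fin n) (Fin n) ℝ) : Matrix (Fin n) (Fin n) ℝ :=
  (S.Ac X)ᵀ * X + X * S.Ac X - X * S.Gc X * X + S.Hc X

/-- The sequence `X` is generated by the fixed-point iteration: `X (k + 1)` is the stabilizing
solution of the algebraic Riccati equation with coefficients frozen at `X k`. -/
def IsFPCARESequence (X : ℕ → Matrix (Fin n) (Fin n) ℝ) : Prop :=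
  ∀ k, IsStabilizingCARESolution (S.Ac (X k)) (S.Gc (X k)) (S.Hc (X k)) (X (k + 1))

end SCAREData

/-! For a feedback gain `F`, `cost Y X F` is affine in `X`, and completing the square shows that
`frozen Y X` is its Loewner minimum over `F`, attained at `gain Y X` (for `X` symmetric, `Y ≥ 0`).
Since `cost` increases with `Y`, so does this minimum (`frozen_mono`). In the other argument, a
stable closed loop at `X` gives a comparison principle (`le_of_frozen_le`), a consequence of the
Lyapunov inequality.

These two facts drive an induction on three properties: `Xhat ≤ X k`, nonpositive residual, and
stability of the closed loop with coefficients and argument both at `X k`. The iteration supplies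
stability only with coefficients frozen one step earlier; `isStableMatrix_step` transfers it to the
updated ones. The sequence is then decreasing and bounded below, so it converges. Continuity of the
coefficients yields the SCARE, and the closed half-plane bound survives the limit
(`re_le_zero_of_mem_spectrum_of_tendsto`). -/

section BanachAlgebra

-- By Gelfand's formula, `‖a ^ k‖ ≤ q ^ k` eventually, for any `q` strictly between the spectral
-- radius and 1.
open Filter Topology ENNReal NNReal in
theorem tendsto_pow_atTop_nhds_zero_of_spectralRadius_lt_one {A : Type*} [NormedRing A]
    [NormedAlgebra ℂ A] [CompleteSpace A] {a : A} (ha : spectralRadius ℂ a < 1) :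
    Tendsto (fun k : ℕ => a ^ k) atTop (𝓝 0) := by
  obtain ⟨q, hq, hq1⟩ := ENNReal.lt_iff_exists_nnreal_btwn.mp ha
  have hq1' : q < 1 := by exact_mod_cast hq1
  have h := (spectrum.pow_nnnorm_pow_one_div_tendsto_nhds_spectralRadius a).eventually_lt_const hq
  refine squeeze_zero_norm' (a := fun k : ℕ => (q : ℝ) ^ k) ?_
    (tendsto_pow_atTop_nhds_zero_of_lt_one q.2 (by exact_mod_cast hq1'))
  filter_upwards [h, eventually_gt_atTop 0] with k hk hk0
  have hk0' : (k : ℝ) ≠ 0 := by positivity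
  have h2 : (‖a ^ k‖₊ : ℝ≥0∞) ≤ (q : ℝ≥0∞) ^ k := by
    have := ENNReal.rpow_le_rpow hk.le (Nat.cast_nonneg k : (0 : ℝ) ≤ k)
    rwa [← ENNReal.rpow_mul, one_div_mul_cancel hk0', ENNReal.rpow_one,
      ENNReal.rpow_natCast] at this
  exact_mod_cast h2

end BanachAlgebra

/-! ### Matrix spectra, Loewner order and Lyapunov quadratic forms. -/

namespace Matrix

variable {n m : ℕ}

open Filter Topology in
attribute [local instance] Matrix.linftyOpNormedRing Matrix.linftyOpNormedAlgebra in
theorem tendsto_pow_atTop_nhds_zero_of_spectrum {M : Matrix (Fin n) (Fin n) ℂ}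
    (hM : ∀ z ∈ spectrum ℂ M, ‖z‖ < 1) :
    Tendsto (fun k : ℕ => M ^ k) atTop (𝓝 0) := by
  have : CompleteSpace (Matrix (Fin n) (Fin n) ℂ) := FiniteDimensional.complete ℂ _
  apply tendsto_pow_atTop_nhds_zero_of_spectralRadius_lt_one
  -- The matrix ring is trivial when `n = 0`; the spectrum is then empty.
  rcases subsingleton_or_nontrivial (Matrix (Fin n) (Fin n) ℂ) with h | h
  · simp [spectralRadius, spectrum.of_subsingleton]
  · have := spectrum.spectralRadius_lt_of_forall_lt M (r := 1) (fun z hz => by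
      exact_mod_cast hM z hz)
    simpa using this

theorem mem_spectrum_iff_exists_mulVec {M : Matrix (Fin n) (Fin n) ℂ} {z : ℂ} :
    z ∈ spectrum ℂ M ↔ ∃ v ≠ 0, M *ᵥ v = z • v := by
  rw [spectrum.mem_iff, Matrix.isUnit_iff_isUnit_det, isUnit_iff_ne_zero, not_not,
    ← Matrix.exists_mulVec_eq_zero_iff]
  refine exists_congr fun v => and_congr_right fun _ => ?_
  rw [Matrix.sub_mulVec, sub_eq_zero, Algebra.algebraMap_eq_smul_one, Matrix.smul_mulVec,
    Matrix.one_mulVec, eq_comm]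

/-- Splitting an eigenvector as `a + i b` keeps all later quadratic form arguments over the reals.
-/
theorem mem_spectrum_map_ofReal_iff {M : Matrix (Fin n) (Fin n) ℝ} {z : ℂ} :
    z ∈ spectrum ℂ (M.map ((↑) : ℝ → ℂ)) ↔ ∃ a b : Fin n → ℝ, (a ≠ 0 ∨ b ≠ 0) ∧
      M *ᵥ a = z.re • a - z.im • b ∧ M *ᵥ b = z.im • a + z.re • b := by
  have key : ∀ v : Fin n → ℂ, (M.map ((↑) : ℝ → ℂ)) *ᵥ v = z • v ↔
      (M *ᵥ (fun i => (v i).re) = z.re • (fun i => (v i).re) - z.im • (fun i => (v i).im) ∧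
      M *ᵥ (fun i => (v i).im) = z.im • (fun i => (v i).re) + z.re • (fun i => (v i).im)) := by
    intro v
    simp only [funext_iff, ← forall_and]
    refine forall_congr' fun i => ?_
    simp only [Complex.ext_iff, Matrix.mulVec, dotProduct, Matrix.map_apply, Complex.re_sum,
      Complex.im_sum, Pi.smul_apply, Pi.sub_apply, Pi.add_apply, smul_eq_mul, Complex.mul_re,
      Complex.mul_im, Complex.ofReal_re, Complex.ofReal_im, zero_mul, sub_zero, add_zero]
    rw [add_comm (z.re * (v i).im)]
  rw [mem_spectrum_iff_exists_mulVec]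
  constructor
  · rintro ⟨v, hv, h⟩
    refine ⟨_, _, ?_, (key v).1 h⟩
    by_contra! hc
    exact hv (funext fun i => Complex.ext (congrFun hc.1 i) (congrFun hc.2 i))
  · rintro ⟨a, b, hab, h⟩
    refine ⟨fun i => ⟨a i, b i⟩, ?_, (key _).2 h⟩
    intro hc
    rcases hab with h | h
    · exact h (funext fun i => congrArg Complex.re (congrFun hc i))
    · exact h (funext fun i => congrArg Complex.im (congrFun hc i))

-- Each eigenvalue `w` of `M k` satisfies `|z - w| ≥ Re z` when `Re z > 0`, so `|det (z - M k)| ≥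
-- (Re z) ^ n`. This uniform bound keeps the limiting determinant away from zero.
open Filter Topology in
theorem re_le_zero_of_mem_spectrum_of_tendsto {M : ℕ → Matrix (Fin n) (Fin n) ℂ}
    {N : Matrix (Fin n) (Fin n) ℂ} (hM : ∀ k, ∀ z ∈ spectrum ℂ (M k), z.re < 0)
    (h : Tendsto M atTop (𝓝 N)) {z : ℂ} (hz : z ∈ spectrum ℂ N) : z.re ≤ 0 := by
  by_contra! hpos
  have hbound : ∀ k, z.re ^ n ≤ ‖(algebraMap ℂ _ z - M k).det‖ := by
    intro k
    have h1 : (algebraMap ℂ _ z - M k).det = (M k).charpoly.eval z := by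
      rw [Matrix.eval_charpoly]; rfl
    have hs := IsAlgClosed.splits (M k).charpoly
    have hcard : (M k).charpoly.roots.card = n := by
      rw [← hs.natDegree_eq_card_roots, Matrix.charpoly_natDegree_eq_dim, Fintype.card_fin]
    rw [h1, hs.eval_eq_prod_roots_of_monic (Matrix.charpoly_monic _)]
    have : ∀ s : Multiset ℂ, (∀ w ∈ s, w.re < 0) →
        z.re ^ s.card ≤ ‖(s.map (fun w => z - w)).prod‖ := by
      intro s
      induction s using Multiset.induction_on with
      | empty => simp
      | cons w s ih =>
        intro hw
        rw [Multiset.card_cons, Multiset.map_cons, Multiset.prod_cons, norm_mul, pow_succ']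
        have h2 : z.re ≤ ‖z - w‖ := by
          have h3 := Complex.re_le_norm (z - w)
          have h4 := hw w (Multiset.mem_cons_self _ _)
          simp only [Complex.sub_re] at h3
          linarith
        exact mul_le_mul h2 (ih fun u hu => hw u (Multiset.mem_cons_of_mem hu))
          (by positivity) (norm_nonneg _)
    have h5 := this (M k).charpoly.roots (fun w hw => hM k w
      (Matrix.mem_spectrum_of_isRoot_charpoly (Polynomial.isRoot_of_mem_roots hw)))
    rwa [hcard] at h5
  have hlim : Tendsto (fun k => ‖(algebraMap ℂ _ z - M k).det‖) atTop
      (𝓝 ‖(algebraMap ℂ _ z - N).det‖) := by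
    have hc : Continuous fun P : Matrix (Fin n) (Fin n) ℂ => ‖(algebraMap ℂ _ z - P).det‖ :=
      (continuous_const.sub continuous_id).matrix_det.norm
    exact (hc.tendsto N).comp h
  have h0 : (algebraMap ℂ _ z - N).det = 0 := by
    by_contra h
    exact hz ((Matrix.isUnit_iff_isUnit_det _).2 (isUnit_iff_ne_zero.2 h))
  have := ge_of_tendsto' hlim hbound
  rw [h0, norm_zero] at this
  exact absurd this (not_le.2 (by positivity))

theorem le_iff_isSymm_and_dotProduct {A B : Matrix (Fin n) (Fin n) ℝ} :
    A ≤ B ↔ (B - A).IsSymm ∧ ∀ x : Fin n → ℝ, x ⬝ᵥ A *ᵥ x ≤ x ⬝ᵥ B *ᵥ x := by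
  rw [Matrix.le_iff, Matrix.posSemidef_iff_dotProduct_mulVec]
  simp [Matrix.IsHermitian, Matrix.IsSymm, Matrix.sub_mulVec]

theorem transpose_mul_mul_same_nonneg {D : Matrix (Fin n) (Fin n) ℝ} (hD : 0 ≤ D)
    (E : Matrix (Fin n) (Fin m) ℝ) : 0 ≤ Eᵀ * D * E := by
  rw [Matrix.nonneg_iff_posSemidef] at *
  simpa using hD.conjTranspose_mul_mul_same E

theorem isSymm_of_nonneg {D : Matrix (Fin n) (Fin n) ℝ} (hD : 0 ≤ D) : D.IsSymm := by
  simpa using (le_iff_isSymm_and_dotProduct.1 hD).1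

theorem dotProduct_transpose_mulVec_comm (x y : Fin n → ℝ) (M : Matrix (Fin n) (Fin n) ℝ) :
    x ⬝ᵥ Mᵀ *ᵥ y = y ⬝ᵥ M *ᵥ x := by
  rw [Matrix.mulVec_transpose, dotProduct_comm, Matrix.dotProduct_mulVec]

theorem dotProduct_transpose_mul_mul_mulVec (x : Fin m → ℝ) (C : Matrix (Fin n) (Fin m) ℝ)
    (D : Matrix (Fin n) (Fin n) ℝ) : x ⬝ᵥ (Cᵀ * D * C) *ᵥ x = (C *ᵥ x) ⬝ᵥ D *ᵥ (C *ᵥ x) := by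
  rw [← Matrix.mulVec_mulVec, ← Matrix.mulVec_mulVec, Matrix.dotProduct_mulVec,
    Matrix.vecMul_transpose]

/-- Discrete-time Lyapunov comparison: if the powers of `C` tend to zero and `D ≤ Cᵀ D C`, then
`D ≤ 0`. -/
theorem le_zero_of_le_transpose_mul_mul {C D : Matrix (Fin n) (Fin n) ℝ}
    (hC : Filter.Tendsto (fun k : ℕ => C ^ k) Filter.atTop (nhds 0)) (hD : D.IsSymm)
    (h : D ≤ Cᵀ * D * C) : D ≤ 0 := by
  rw [le_iff_isSymm_and_dotProduct] at h ⊢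
  refine ⟨by simpa using hD, fun x => ?_⟩
  have hx : ∀ k : ℕ, x ⬝ᵥ D *ᵥ x ≤ (C ^ k *ᵥ x) ⬝ᵥ D *ᵥ (C ^ k *ᵥ x) := by
    intro k
    induction k with
    | zero => simp
    | succ k ih =>
      refine ih.trans ((h.2 _).trans_eq ?_)
      rw [dotProduct_transpose_mul_mul_mulVec, Matrix.mulVec_mulVec, pow_succ']
  have hc : Continuous fun P : Matrix (Fin n) (Fin n) ℝ => (P *ᵥ x) ⬝ᵥ D *ᵥ (P *ᵥ x) := by
    fun_prop
  simpa using ge_of_tendsto' ((hc.tendsto 0).comp hC) hx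

/-- Real form of `v* (Mᵀ D + D M) v = 2 Re(z) v* D v` for an eigenvector `v = a + i b`; the cross
terms cancel because `D` is symmetric. -/
theorem quadraticForm_lyapunov_of_eigenpair {M D : Matrix (Fin n) (Fin n) ℝ} (hD : D.IsSymm)
    {a b : Fin n → ℝ} {s t : ℝ} (ha : M *ᵥ a = s • a - t • b) (hb : M *ᵥ b = t • a + s • b) :
    a ⬝ᵥ (Mᵀ * D + D * M) *ᵥ a + b ⬝ᵥ (Mᵀ * D + D * M) *ᵥ b
      = 2 * s * (a ⬝ᵥ D *ᵥ a + b ⬝ᵥ D *ᵥ b) := by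
  have hq : ∀ x : Fin n → ℝ, x ⬝ᵥ (Mᵀ * D + D * M) *ᵥ x = 2 * (x ⬝ᵥ D *ᵥ (M *ᵥ x)) := by
    intro x
    have h1 : Mᵀ * D = (D * M)ᵀ := by rw [Matrix.transpose_mul, hD.eq]
    rw [Matrix.add_mulVec, dotProduct_add, h1, dotProduct_transpose_mulVec_comm,
      ← Matrix.mulVec_mulVec]
    ring
  have hs : b ⬝ᵥ D *ᵥ a = a ⬝ᵥ D *ᵥ b := by
    conv_rhs => rw [← hD.eq, dotProduct_transpose_mulVec_comm]
  rw [hq, hq, ha, hb]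
  simp only [Matrix.mulVec_sub, Matrix.mulVec_add, Matrix.mulVec_smul, dotProduct_add,
    dotProduct_sub, dotProduct_smul, smul_eq_mul, hs]
  ring

end Matrix

/-! ### Stable matrices: Cayley transform and Lyapunov comparison. -/

namespace IsStableMatrix

open Matrix

variable {n : ℕ} {T : Matrix (Fin n) (Fin n) ℝ}

theorem isUnit_one_sub (hT : IsStableMatrix T) : IsUnit (1 - T) := by
  rw [Matrix.isUnit_iff_isUnit_det, isUnit_iff_ne_zero]
  intro h0
  obtain ⟨v, hv, h⟩ := Matrix.exists_mulVec_eq_zero_iff.2 h0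
  rw [Matrix.sub_mulVec, Matrix.one_mulVec, sub_eq_zero] at h
  have := hT 1 (mem_spectrum_map_ofReal_iff.2 ⟨v, 0, Or.inl hv, by simp [← h], by simp⟩)
  simp at this
  linarith

/-- An eigenvalue `z` of the Cayley transform gives the eigenvalue `(z - 1) / (1 + z)` of `T`, whose
real part has the sign of `|z|² - 1`. Stability thus puts the transformed spectrum in the open unit
disc. -/
theorem tendsto_cayley_pow (hT : IsStableMatrix T) :
    Filter.Tendsto (fun k : ℕ => ((1 + T) * (1 - T)⁻¹) ^ k) Filter.atTop (nhds 0) := by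
  set f : Matrix (Fin n) (Fin n) ℝ →+* Matrix (Fin n) (Fin n) ℂ := Complex.ofRealHom.mapMatrix
  set C := (1 + T) * (1 - T)⁻¹ with hCdef
  have hC : C * (1 - T) = 1 + T := by
    rw [hCdef, Matrix.mul_assoc, Matrix.nonsing_inv_mul _
      ((Matrix.isUnit_iff_isUnit_det _).1 hT.isUnit_one_sub), Matrix.mul_one]
  have hu : (1 - T) * (1 - T)⁻¹ = 1 := Matrix.mul_nonsing_inv _
      ((Matrix.isUnit_iff_isUnit_det _).1 hT.isUnit_one_sub)
  have hspec : ∀ z ∈ spectrum ℂ (f C), ‖z‖ < 1 := by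
    intro z hz
    obtain ⟨v, hv, h⟩ := mem_spectrum_iff_exists_mulVec.1 hz
    set w := f (1 - T)⁻¹ *ᵥ v with hw
    have hvw : v = w - f T *ᵥ w := by
      have : f (1 - T) *ᵥ w = v := by
        rw [hw, Matrix.mulVec_mulVec, ← map_mul, hu, map_one, Matrix.one_mulVec]
      rw [← this, map_sub, map_one, Matrix.sub_mulVec, Matrix.one_mulVec]
    have hCv : f C *ᵥ v = w + f T *ᵥ w := by
      rw [hCdef, map_mul, ← Matrix.mulVec_mulVec, ← hw, map_add, map_one, Matrix.add_mulVec,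
        Matrix.one_mulVec]
    have hw0 : w ≠ 0 := by
      intro h0
      rw [h0] at hvw
      simp at hvw
      exact hv hvw
    rw [hCv, hvw] at h
    have h1 : (1 + z) • (f T *ᵥ w) = (z - 1) • w := by
      rw [smul_sub] at h
      have := congrArg (fun y => y - w + z • (f T *ᵥ w)) h
      simp only [add_sub_cancel_left] at this
      rw [add_smul, one_smul, this, sub_smul, one_smul]
      abel
    have hz1 : 1 + z ≠ 0 := by
      intro h0
      rw [h0, zero_smul] at h1
      have : z - 1 = 0 := (smul_eq_zero.1 h1.symm).resolve_right hw0
      have h2 : (2 : ℂ) = 0 := by linear_combination h0 - this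
      norm_num at h2
    have h2 : f T *ᵥ w = ((z - 1) / (1 + z)) • w := by
      rw [div_eq_inv_mul, mul_smul, ← h1, smul_smul, inv_mul_cancel₀ hz1, one_smul]
    have h3 := hT _ (mem_spectrum_iff_exists_mulVec.2 ⟨w, hw0, h2⟩)
    have hns : 0 < Complex.normSq (1 + z) := Complex.normSq_pos.2 hz1
    rw [Complex.div_re, ← add_div, div_neg_iff] at h3
    have h4 := (h3.resolve_left fun h => absurd h.2 (not_lt.2 hns.le)).1
    simp at h4
    have h5 : ‖z‖ ^ 2 < 1 := by
      rw [← Complex.normSq_eq_norm_sq, Complex.normSq_apply]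
      nlinarith
    nlinarith [norm_nonneg z]
  have hlim := tendsto_pow_atTop_nhds_zero_of_spectrum hspec
  have hre : Continuous fun P : Matrix (Fin n) (Fin n) ℂ => P.map Complex.re :=
    continuous_id.matrix_map Complex.continuous_re
  have := (hre.tendsto 0).comp hlim
  refine (this.congr fun k => ?_).trans_eq (by simp)
  rw [Function.comp_apply, ← map_pow]
  ext i j
  simp [f]

/-- Lyapunov comparison: if `T` is stable and `Tᵀ D + D T ≥ 0` then `D ≤ 0`. -/
theorem le_zero_of_lyapunov_nonneg (hT : IsStableMatrix T) {D : Matrix (Fin n) (Fin n) ℝ}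
    (hD : D.IsSymm) (h : 0 ≤ Tᵀ * D + D * T) : D ≤ 0 := by
  refine le_zero_of_le_transpose_mul_mul hT.tendsto_cayley_pow hD ?_
  have hu : (1 - T) * (1 - T)⁻¹ = 1 := Matrix.mul_nonsing_inv _
      ((Matrix.isUnit_iff_isUnit_det _).1 hT.isUnit_one_sub)
  have hD' : D = ((1 - T)⁻¹)ᵀ * ((1 - T)ᵀ * D * (1 - T)) * (1 - T)⁻¹ := by
    have : ((1 - T)⁻¹)ᵀ * (1 - T)ᵀ = 1 := by rw [← Matrix.transpose_mul, hu, Matrix.transpose_one]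
    calc D = (((1 - T)⁻¹)ᵀ * (1 - T)ᵀ) * D * ((1 - T) * (1 - T)⁻¹) := by
            rw [this, hu, Matrix.one_mul, Matrix.mul_one]
      _ = _ := by simp only [Matrix.mul_assoc]
  -- The point is `(1 + T)ᵀ D (1 + T) - (1 - T)ᵀ D (1 - T) = 2 (Tᵀ D + D T)`.
  have hdiff : ((1 + T) * (1 - T)⁻¹)ᵀ * D * ((1 + T) * (1 - T)⁻¹) - D =
      ((1 - T)⁻¹)ᵀ * ((Tᵀ * D + D * T) + (Tᵀ * D + D * T)) * (1 - T)⁻¹ := by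
    conv_lhs => rhs; rw [hD']
    have : ((1 + T) * (1 - T)⁻¹)ᵀ * D * ((1 + T) * (1 - T)⁻¹) =
        ((1 - T)⁻¹)ᵀ * ((1 + T)ᵀ * D * (1 + T)) * (1 - T)⁻¹ := by
      rw [Matrix.transpose_mul]; simp only [Matrix.mul_assoc]
    rw [this, ← Matrix.sub_mul, ← Matrix.mul_sub]
    congr 2
    simp only [Matrix.transpose_add, Matrix.transpose_sub, Matrix.transpose_one]
    noncomm_ring
  rw [← sub_nonneg, hdiff]
  exact transpose_mul_mul_same_nonneg (add_nonneg h h) _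

end IsStableMatrix

/-! ### Monotone convergence in the Loewner order. -/

namespace Matrix

-- Each quadratic form is a bounded monotone real sequence; polarization on the standard basis
-- recovers the entries.
open Filter Topology in
theorem exists_tendsto_of_antitone {n : ℕ} {X : ℕ → Matrix (Fin n) (Fin n) ℝ}
    {Y : Matrix (Fin n) (Fin n) ℝ} (hsymm : ∀ k, (X k).IsSymm) (hX : ∀ k, X (k + 1) ≤ X k)
    (hY : ∀ k, Y ≤ X k) : ∃ Z, Tendsto X atTop (𝓝 Z) := by
  have hq : ∀ x : Fin n → ℝ, ∃ l, Tendsto (fun k => x ⬝ᵥ X k *ᵥ x) atTop (𝓝 l) := by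
    intro x
    refine ⟨_, tendsto_atTop_ciInf (antitone_nat_of_succ_le fun k =>
      (le_iff_isSymm_and_dotProduct.1 (hX k)).2 x) ⟨x ⬝ᵥ Y *ᵥ x, ?_⟩⟩
    rintro _ ⟨k, rfl⟩
    exact (le_iff_isSymm_and_dotProduct.1 (hY k)).2 x
  choose q hq using hq
  let e : Fin n → Fin n → ℝ := fun i => Pi.single i 1
  refine ⟨Matrix.of fun i j => (q (e i + e j) - q (e i) - q (e j)) / 2, ?_⟩
  refine tendsto_pi_nhds.2 fun i => tendsto_pi_nhds.2 fun j => ?_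
  refine ((((hq (e i + e j)).sub (hq (e i))).sub (hq (e j))).div_const 2).congr fun k => ?_
  have := (hsymm k).apply i j
  simp [e, Matrix.mulVec_add, add_dotProduct]
  linarith

theorem isClosed_Ici_loewner {n : ℕ} (Y : Matrix (Fin n) (Fin n) ℝ) : IsClosed {X | Y ≤ X} := by
  simp only [le_iff_isSymm_and_dotProduct, Matrix.IsSymm, Set.ofPred_and, Set.ofPred_forall]
  refine (isClosed_eq (by fun_prop) (by fun_prop)).inter (isClosed_iInter fun x => ?_)
  exact isClosed_le (by fun_prop) (by fun_prop)

end Matrix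

/-! ### Frozen Riccati operators: variational form, monotonicity, comparison. -/

namespace SCAREData

open Matrix

variable {n m r : ℕ} (S : SCAREData n m r)

/-- The left-hand side of the Riccati equation in `X` with coefficients frozen at `Y`. -/
noncomputable def frozen (Y X : Matrix (Fin n) (Fin n) ℝ) : Matrix (Fin n) (Fin n) ℝ :=
  (S.Ac Y)ᵀ * X + X * S.Ac Y - X * S.Gc Y * X + S.Hc Y

/-- The minimizing feedback gain for the Riccati operator with coefficients frozen at `Y`. -/
noncomputable def gain (Y X : Matrix (Fin n) (Fin n) ℝ) : Matrix (Fin m) (Fin n) ℝ :=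
  -((S.Rc Y)⁻¹ * (X * S.B + S.Lc Y)ᵀ)

/-- The part of `cost` that does not depend on `X`. -/
def stageCost (Y : Matrix (Fin n) (Fin n) ℝ) (F : Matrix (Fin m) (Fin n) ℝ) :
    Matrix (Fin n) (Fin n) ℝ :=
  S.Qc Y + S.Lc Y * F + Fᵀ * (S.Lc Y)ᵀ + Fᵀ * S.Rc Y * F

/-- The Lyapunov operator of the feedback `F`, with weights frozen at `Y`. -/
def cost (Y X : Matrix (Fin n) (Fin n) ℝ) (F : Matrix (Fin m) (Fin n) ℝ) :
    Matrix (Fin n) (Fin n) ℝ :=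
  (S.A + S.B * F)ᵀ * X + X * (S.A + S.B * F) + S.stageCost Y F

theorem residual_eq_frozen (X : Matrix (Fin n) (Fin n) ℝ) : S.residual X = S.frozen X X := rfl

variable {S}

theorem posDef_Rc (hR : S.R.PosDef) {Y : Matrix (Fin n) (Fin n) ℝ} (hY : 0 ≤ Y) :
    (S.Rc Y).PosDef := by
  refine hR.add_posSemidef (Matrix.nonneg_iff_posSemidef.1 ?_)
  exact Finset.sum_nonneg fun i _ => transpose_mul_mul_same_nonneg hY _

theorem frozen_eq (hR : S.R.PosDef) {X Y : Matrix (Fin n) (Fin n) ℝ} (hX : X.IsSymm)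
    (hY : 0 ≤ Y) : S.frozen Y X = S.Aᵀ * X + X * S.A + S.Qc Y -
      (X * S.B + S.Lc Y) * (S.Rc Y)⁻¹ * (X * S.B + S.Lc Y)ᵀ := by
  have hK : ((S.Rc Y)⁻¹)ᵀ = (S.Rc Y)⁻¹ := by
    simpa using (posDef_Rc hR hY).inv.isHermitian.eq
  simp only [frozen, Ac, Gc, Hc, Matrix.transpose_add, Matrix.transpose_sub,
    Matrix.transpose_mul, Matrix.transpose_transpose, hK, hX.eq, Matrix.mul_add, Matrix.add_mul,
    Matrix.mul_sub, Matrix.sub_mul, Matrix.mul_assoc]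
  abel

theorem isSolution_iff_residual_eq_zero (hR : S.R.PosDef) {X : Matrix (Fin n) (Fin n) ℝ}
    (hX : 0 ≤ X) : S.IsSolution X ↔ S.residual X = 0 := by
  rw [residual_eq_frozen, frozen_eq hR (isSymm_of_nonneg hX) hX, IsSolution]
  simp only [Qc, Lc, Rc, add_assoc]

theorem Ac_sub_Gc_mul {X : Matrix (Fin n) (Fin n) ℝ} (hX : X.IsSymm)
    (Y : Matrix (Fin n) (Fin n) ℝ) : S.Ac Y - S.Gc Y * X = S.A + S.B * S.gain Y X := by
  simp only [Ac, Gc, gain, Matrix.transpose_add, Matrix.transpose_mul, hX.eq, Matrix.mul_neg,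
    Matrix.mul_add, Matrix.mul_assoc]
  abel

/-- Completion of the square in `F`. -/
theorem cost_eq (hR : S.R.PosDef) {X Y : Matrix (Fin n) (Fin n) ℝ} (hX : X.IsSymm)
    (hY : 0 ≤ Y) (F : Matrix (Fin m) (Fin n) ℝ) : S.cost Y X F = S.frozen Y X +
      (F - S.gain Y X)ᵀ * S.Rc Y * (F - S.gain Y X) := by
  have hP := posDef_Rc hR hY
  have hK : ((S.Rc Y)⁻¹)ᵀ = (S.Rc Y)⁻¹ := by simpa using hP.inv.isHermitian.eq
  have hu : IsUnit (S.Rc Y).det := (Matrix.isUnit_iff_isUnit_det _).1 hP.isUnit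
  rw [frozen_eq hR hX hY]
  set N := X * S.B + S.Lc Y with hN
  have hNF : N * F = X * (S.B * F) + S.Lc Y * F := by
    rw [hN, Matrix.add_mul, Matrix.mul_assoc]
  have hFN : Fᵀ * Nᵀ = Fᵀ * (S.Bᵀ * X) + Fᵀ * (S.Lc Y)ᵀ := by
    rw [hN, Matrix.transpose_add, Matrix.transpose_mul, hX.eq, Matrix.mul_add]
  have h1 : (F - S.gain Y X)ᵀ * S.Rc Y = Fᵀ * S.Rc Y + N := by
    rw [gain, sub_neg_eq_add, Matrix.transpose_add, Matrix.transpose_mul,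
      Matrix.transpose_transpose, hK, Matrix.add_mul, Matrix.nonsing_inv_mul_cancel_right _ _ hu]
  have h2 : (F - S.gain Y X)ᵀ * S.Rc Y * (F - S.gain Y X) =
      Fᵀ * S.Rc Y * F + Fᵀ * Nᵀ + N * F + N * (S.Rc Y)⁻¹ * Nᵀ := by
    have h3 : S.Rc Y * ((S.Rc Y)⁻¹ * Nᵀ) = Nᵀ := Matrix.mul_nonsing_inv_cancel_left _ _ hu
    rw [h1, gain, sub_neg_eq_add, ← hN]
    simp only [Matrix.mul_add (_ : Matrix (Fin n) (Fin m) ℝ), Matrix.add_mul (Fᵀ * S.Rc Y) N,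
      Matrix.mul_assoc, h3]
    abel
  rw [h2, hNF, hFN, cost, stageCost]
  simp only [Matrix.transpose_add, Matrix.transpose_mul, Matrix.add_mul, Matrix.mul_add,
    Matrix.mul_assoc]
  abel

theorem frozen_le_cost (hR : S.R.PosDef) {X Y : Matrix (Fin n) (Fin n) ℝ} (hX : X.IsSymm)
    (hY : 0 ≤ Y) (F : Matrix (Fin m) (Fin n) ℝ) : S.frozen Y X ≤ S.cost Y X F := by
  rw [cost_eq hR hX hY]
  exact le_add_of_nonneg_right (transpose_mul_mul_same_nonneg
    (Matrix.nonneg_iff_posSemidef.2 (posDef_Rc hR hY).posSemidef) _)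

theorem cost_gain (hR : S.R.PosDef) {X Y : Matrix (Fin n) (Fin n) ℝ} (hX : X.IsSymm)
    (hY : 0 ≤ Y) : S.cost Y X (S.gain Y X) = S.frozen Y X := by
  simp [cost_eq hR hX hY]

/-- `Y` enters only through the noise terms, so the difference is a sum of congruences of `Z - Y` by
the closed-loop noise matrices `A0 i + B0 i * F`. -/
theorem cost_mono {Y Z : Matrix (Fin n) (Fin n) ℝ} (hYZ : Y ≤ Z)
    (X : Matrix (Fin n) (Fin n) ℝ) (F : Matrix (Fin m) (Fin n) ℝ) :
    S.cost Y X F ≤ S.cost Z X F := by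
  have hZY : (Z - Y).IsSymm := isSymm_of_nonneg (sub_nonneg.2 hYZ)
  have key : S.cost Z X F - S.cost Y X F =
      ∑ i, (S.A0 i + S.B0 i * F)ᵀ * (Z - Y) * (S.A0 i + S.B0 i * F) := by
    have h12 : (S.Pi12 Z)ᵀ - (S.Pi12 Y)ᵀ = ∑ i, (S.B0 i)ᵀ * (Z - Y) * S.A0 i := by
      simp only [Pi12, ← Matrix.transpose_sub, ← Finset.sum_sub_distrib, ← Matrix.sub_mul,
        ← Matrix.mul_sub, Matrix.transpose_sum, Matrix.transpose_mul, Matrix.transpose_transpose,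
        hZY.eq, Matrix.mul_assoc]
    calc S.cost Z X F - S.cost Y X F
        = (S.Pi11 Z - S.Pi11 Y) + (S.Pi12 Z - S.Pi12 Y) * F +
          Fᵀ * ((S.Pi12 Z)ᵀ - (S.Pi12 Y)ᵀ) + Fᵀ * (S.Pi22 Z - S.Pi22 Y) * F := by
          simp only [cost, stageCost, Qc, Lc, Rc, Matrix.transpose_add, Matrix.add_mul,
            Matrix.mul_add, Matrix.sub_mul, Matrix.mul_sub]
          abel
      _ = _ := by
          rw [h12]
          simp only [Pi11, Pi12, Pi22, ← Finset.sum_sub_distrib, ← Matrix.sub_mul,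
            ← Matrix.mul_sub, Matrix.sum_mul, Matrix.mul_sum,
            ← Finset.sum_add_distrib]
          refine Finset.sum_congr rfl fun i _ => ?_
          simp only [Matrix.transpose_add, Matrix.transpose_mul, Matrix.add_mul, Matrix.mul_add,
            Matrix.mul_assoc]
          abel
  rw [← sub_nonneg, key]
  exact Finset.sum_nonneg fun i _ => transpose_mul_mul_same_nonneg (sub_nonneg.2 hYZ) _

theorem frozen_mono (hR : S.R.PosDef) {X Y Z : Matrix (Fin n) (Fin n) ℝ} (hX : X.IsSymm)
    (hY : 0 ≤ Y) (hYZ : Y ≤ Z) : S.frozen Y X ≤ S.frozen Z X :=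
  (frozen_le_cost hR hX hY (S.gain Z X)).trans
    ((cost_mono hYZ X _).trans_eq (cost_gain hR hX (hY.trans hYZ)))

/-- Exact second-order expansion at `X`: the linear part is the Lyapunov operator of the closed
loop. -/
theorem frozen_sub_frozen_add (hR : S.R.PosDef) {Y X Z : Matrix (Fin n) (Fin n) ℝ} (hY : 0 ≤ Y)
    (hX : X.IsSymm) : S.frozen Y Z - S.frozen Y X + (Z - X) * S.Gc Y * (Z - X) =
      (S.Ac Y - S.Gc Y * X)ᵀ * (Z - X) + (Z - X) * (S.Ac Y - S.Gc Y * X) := by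
  have hK : ((S.Rc Y)⁻¹)ᵀ = (S.Rc Y)⁻¹ := by
    simpa using (posDef_Rc hR hY).inv.isHermitian.eq
  have hG : (S.Gc Y)ᵀ = S.Gc Y := by
    simp only [Gc, Matrix.transpose_mul, Matrix.transpose_transpose, hK, Matrix.mul_assoc]
  simp only [frozen, Matrix.transpose_sub, Matrix.transpose_mul, hG, hX.eq]
  noncomm_ring

theorem Gc_nonneg (hR : S.R.PosDef) {Y : Matrix (Fin n) (Fin n) ℝ} (hY : 0 ≤ Y) :
    0 ≤ S.Gc Y := by
  simpa [Gc] using transpose_mul_mul_same_nonneg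
    (Matrix.nonneg_iff_posSemidef.2 (posDef_Rc hR hY).inv.posSemidef) S.Bᵀ

/-- Comparison principle: if the closed loop at `X` is stable and the frozen Riccati operator at
`Z` dominates that at `X`, then `Z ≤ X`. -/
theorem le_of_frozen_le (hR : S.R.PosDef) {Y X Z : Matrix (Fin n) (Fin n) ℝ} (hY : 0 ≤ Y)
    (hX : X.IsSymm) (hZ : Z.IsSymm) (hstab : IsStableMatrix (S.Ac Y - S.Gc Y * X))
    (h : S.frozen Y X ≤ S.frozen Y Z) : Z ≤ X := by
  have hD : (Z - X).IsSymm := hZ.sub hX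
  rw [← sub_nonpos]
  refine hstab.le_zero_of_lyapunov_nonneg hD ?_
  rw [← frozen_sub_frozen_add hR hY hX]
  refine add_nonneg (sub_nonneg.2 h) ?_
  have := transpose_mul_mul_same_nonneg (Gc_nonneg hR hY) (Z - X)
  rwa [hD.eq] at this

/-- With `D = X - Xhat ≥ 0`, the new closed loop `M` satisfies `Mᵀ D + D M ≤ -E`, where `E ≥ 0`
measures the change of gain. At an eigenvector with `Re z ≥ 0` the left form is nonnegative, so `E`
vanishes there and the two gains agree on it. It is then an eigenvector of the old, stable closed
loop for the same `z`. -/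
theorem isStableMatrix_step (hR : S.R.PosDef) {Xhat Y X : Matrix (Fin n) (Fin n) ℝ}
    (hXhat : 0 ≤ Xhat) (hsol : 0 ≤ S.residual Xhat) (hle : Xhat ≤ X) (hXY : X ≤ Y)
    (hX : S.frozen Y X ≤ 0) (hstab : IsStableMatrix (S.Ac Y - S.Gc Y * X)) :
    IsStableMatrix (S.Ac X - S.Gc X * X) := by
  have hX0 : 0 ≤ X := hXhat.trans hle
  have hXs := isSymm_of_nonneg hX0
  have hY0 : 0 ≤ Y := hX0.trans hXY
  rw [Ac_sub_Gc_mul hXs] at hstab ⊢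
  set F := S.gain Y X
  set F' := S.gain X X
  set E := (F - F')ᵀ * S.Rc X * (F - F') with hE
  set M := S.A + S.B * F' with hM
  -- `E` is the excess cost of keeping the old gain `F` under the updated coefficients.
  have h1 : S.frozen X X + E ≤ 0 := by
    rw [← cost_eq hR hXs hX0]
    exact (cost_mono hXY X F).trans ((cost_gain hR hXs hY0).trans_le hX)
  have h2 : 0 ≤ S.cost X Xhat F' :=
    hsol.trans ((frozen_mono hR (isSymm_of_nonneg hXhat) hXhat hle).trans
      (frozen_le_cost hR (isSymm_of_nonneg hXhat) hX0 F'))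
  have h3 : Mᵀ * (X - Xhat) + (X - Xhat) * M ≤ -E := by
    -- Both costs use the gain `F'`, so their stage costs cancel.
    have h4 : Mᵀ * (X - Xhat) + (X - Xhat) * M = S.frozen X X - S.cost X Xhat F' := by
      rw [← cost_gain hR hXs hX0, cost, cost, ← hM]
      noncomm_ring
    rw [h4]
    exact (sub_le_self _ h2).trans (le_neg_iff_add_nonpos_right.2 h1)
  intro z hz
  obtain ⟨a, b, hab, ha, hb⟩ := mem_spectrum_map_ofReal_iff.1 hz
  by_contra! hz0
  have hquad := quadraticForm_lyapunov_of_eigenpair (isSymm_of_nonneg (sub_nonneg.2 hle)) ha hb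
  have hqE : ∀ x, x ⬝ᵥ E *ᵥ x = ((F - F') *ᵥ x) ⬝ᵥ S.Rc X *ᵥ ((F - F') *ᵥ x) := fun x =>
    dotProduct_transpose_mul_mul_mulVec x _ _
  have hPD := posDef_Rc hR hX0
  have hqE0 : ∀ x, 0 ≤ x ⬝ᵥ E *ᵥ x := fun x => by
    rw [hqE]
    simpa using hPD.posSemidef.dotProduct_mulVec_nonneg ((F - F') *ᵥ x)
  have hD0 : ∀ x, 0 ≤ x ⬝ᵥ (X - Xhat) *ᵥ x := fun x => by
    simpa using (le_iff_isSymm_and_dotProduct.1 (sub_nonneg.2 hle)).2 x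
  have hle3 : ∀ x, x ⬝ᵥ (Mᵀ * (X - Xhat) + (X - Xhat) * M) *ᵥ x ≤ -(x ⬝ᵥ E *ᵥ x) := fun x => by
    simpa [Matrix.neg_mulVec] using (le_iff_isSymm_and_dotProduct.1 h3).2 x
  have hnn : 0 ≤ 2 * z.re * (a ⬝ᵥ (X - Xhat) *ᵥ a + b ⬝ᵥ (X - Xhat) *ᵥ b) :=
    mul_nonneg (by linarith) (add_nonneg (hD0 a) (hD0 b))
  have hker : ∀ x, x ⬝ᵥ E *ᵥ x = 0 → (S.A + S.B * F) *ᵥ x = M *ᵥ x := by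
    intro x hx
    have : (F - F') *ᵥ x = 0 := by
      by_contra hne
      have := hPD.dotProduct_mulVec_pos hne
      rw [hqE] at hx
      rw [star_trivial, hx] at this
      exact this.false
    rw [Matrix.sub_mulVec, sub_eq_zero] at this
    rw [hM, Matrix.add_mulVec, Matrix.add_mulVec, ← Matrix.mulVec_mulVec, this,
      Matrix.mulVec_mulVec]
  have ha0 : a ⬝ᵥ E *ᵥ a = 0 := by linarith [hle3 a, hle3 b, hqE0 a, hqE0 b]
  have hb0 : b ⬝ᵥ E *ᵥ b = 0 := by linarith [hle3 a, hle3 b, hqE0 a, hqE0 b]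
  exact absurd (hstab z (mem_spectrum_map_ofReal_iff.2
    ⟨a, b, hab, (hker a ha0).trans ha, (hker b hb0).trans hb⟩)) (not_lt.2 hz0)

/-! ### Continuity of the coefficients on the positive semidefinite cone. -/

section Continuity

theorem continuous_Pi11 : Continuous S.Pi11 := by unfold Pi11; fun_prop

theorem continuous_Lc : Continuous S.Lc := by unfold Lc Pi12; fun_prop

theorem continuous_Rc : Continuous S.Rc := by unfold Rc Pi22; fun_prop

theorem continuousAt_Rc_inv (hR : S.R.PosDef) {X : Matrix (Fin n) (Fin n) ℝ} (hX : 0 ≤ X) :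
    ContinuousAt (fun Y => (S.Rc Y)⁻¹) X := by
  have hdet : (S.Rc X).det ≠ 0 :=
    isUnit_iff_ne_zero.1 ((Matrix.isUnit_iff_isUnit_det _).1 (posDef_Rc hR hX).isUnit)
  refine ContinuousAt.comp (f := S.Rc) (g := fun P => P⁻¹) ?_ continuous_Rc.continuousAt
  refine continuousAt_matrix_inv _ ?_
  simp only [Ring.inverse_eq_inv']
  exact continuousAt_inv₀ hdet

theorem continuousAt_Ac (hR : S.R.PosDef) {X : Matrix (Fin n) (Fin n) ℝ} (hX : 0 ≤ X) :
    ContinuousAt S.Ac X := by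
  have h1 := continuousAt_Rc_inv hR hX
  have h2 := (continuous_Lc (S := S)).continuousAt (x := X)
  unfold Ac
  fun_prop

theorem continuousAt_Gc (hR : S.R.PosDef) {X : Matrix (Fin n) (Fin n) ℝ} (hX : 0 ≤ X) :
    ContinuousAt S.Gc X := by
  have h1 := continuousAt_Rc_inv hR hX
  unfold Gc
  fun_prop

theorem continuousAt_Hc (hR : S.R.PosDef) {X : Matrix (Fin n) (Fin n) ℝ} (hX : 0 ≤ X) :
    ContinuousAt S.Hc X := by
  have h1 := continuousAt_Rc_inv hR hX
  have h2 := (continuous_Lc (S := S)).continuousAt (x := X)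
  have h3 := (continuous_Pi11 (S := S)).continuousAt (x := X)
  unfold Hc Qc
  fun_prop

end Continuity

end SCAREData

/-! ### The monotone iteration and its limit. -/

open Filter Topology in
theorem mainTheorem2 {n m r : ℕ} (S : SCAREData n m r)
    (hQ : S.Q.IsSymm) (hR : S.R.PosDef)
    (Xhat : Matrix (Fin n) (Fin n) ℝ) (hXhat : 0 ≤ Xhat) (hsol : S.IsSolution Xhat)
    (X : ℕ → Matrix (Fin n) (Fin n) ℝ) (hX : S.IsFPCARESequence X)
    (hX0 : Xhat ≤ X 0) (hstab : IsStableMatrix (S.Ac (X 0) - S.Gc (X 0) * X 0))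
    (hres : S.residual (X 0) ≤ 0) :
    (∀ k, X (k + 1) ≤ X k ∧ Xhat ≤ X k ∧ S.residual (X k) ≤ 0) ∧
    ∃ Xplus : Matrix (Fin n) (Fin n) ℝ,
      Filter.Tendsto X Filter.atTop (nhds Xplus) ∧
      0 ≤ Xplus ∧ Xhat ≤ Xplus ∧ S.IsSolution Xplus ∧
      ∀ z ∈ spectrum ℂ ((S.Ac Xplus - S.Gc Xplus * Xplus).map ((↑) : ℝ → ℂ)), z.re ≤ 0 := by
  have hhat : S.residual Xhat = 0 := (SCAREData.isSolution_iff_residual_eq_zero hR hXhat).1 hsol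
  have hzero : ∀ k, S.frozen (X k) (X (k + 1)) = 0 := fun k => (hX k).2.1
  have hinv : ∀ k, Xhat ≤ X k → S.residual (X k) ≤ 0 →
      IsStableMatrix (S.Ac (X k) - S.Gc (X k) * X k) → X (k + 1) ≤ X k ∧ Xhat ≤ X (k + 1) := by
    intro k h1 h2 h3
    have hk0 := hXhat.trans h1
    -- The first comparison uses the closed loop at `X k`, the second the one at `X (k + 1)`, both
    -- with coefficients frozen at `X k`.
    refine ⟨SCAREData.le_of_frozen_le hR hk0 (Matrix.isSymm_of_nonneg hk0) (hX k).1 h3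
      ((S.residual_eq_frozen _).symm.trans_le (h2.trans_eq (hzero k).symm)),
      SCAREData.le_of_frozen_le hR hk0 (hX k).1 (Matrix.isSymm_of_nonneg hXhat) (hX k).2.2 ?_⟩
    rw [hzero k, ← hhat]
    exact SCAREData.frozen_mono hR (Matrix.isSymm_of_nonneg hXhat) hXhat h1
  have hind : ∀ k, Xhat ≤ X k ∧ S.residual (X k) ≤ 0 ∧
      IsStableMatrix (S.Ac (X k) - S.Gc (X k) * X k) := by
    intro k
    induction k with
    | zero => exact ⟨hX0, hres, hstab⟩
    | succ k ih =>
      obtain ⟨hle, hge⟩ := hinv k ih.1 ih.2.1 ih.2.2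
      refine ⟨hge, ?_, SCAREData.isStableMatrix_step hR hXhat hhat.ge hge hle (hzero k).le
        (hX k).2.2⟩
      rw [S.residual_eq_frozen, ← hzero k]
      exact SCAREData.frozen_mono hR (hX k).1 (hXhat.trans hge) hle
  have hdec : ∀ k, X (k + 1) ≤ X k := fun k => (hinv k (hind k).1 (hind k).2.1 (hind k).2.2).1
  refine ⟨fun k => ⟨hdec k, (hind k).1, (hind k).2.1⟩, ?_⟩
  obtain ⟨P, hP⟩ := Matrix.exists_tendsto_of_antitone
    (fun k => Matrix.isSymm_of_nonneg (hXhat.trans (hind k).1)) hdec fun k => (hind k).1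
  have hPge : Xhat ≤ P := (Matrix.isClosed_Ici_loewner Xhat).mem_of_tendsto hP
    (Eventually.of_forall fun k => (hind k).1)
  have hP0 : 0 ≤ P := hXhat.trans hPge
  have hA := (SCAREData.continuousAt_Ac hR hP0).tendsto.comp hP
  have hG := (SCAREData.continuousAt_Gc hR hP0).tendsto.comp hP
  have hH := (SCAREData.continuousAt_Hc hR hP0).tendsto.comp hP
  have hP1 := hP.comp (tendsto_add_atTop_nat 1)
  refine ⟨P, hP, hP0, hPge, ?_, ?_⟩
  · rw [SCAREData.isSolution_iff_residual_eq_zero hR hP0]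
    have hT : Continuous fun M : Matrix (Fin n) (Fin n) ℝ => Mᵀ := by fun_prop
    have hlim : Tendsto (fun k => S.frozen (X k) (X (k + 1))) atTop (𝓝 (S.residual P)) :=
      (((((hT.tendsto _).comp hA).mul hP1).add (hP1.mul hA)).sub ((hP1.mul hG).mul hP1)).add hH
    simp only [hzero] at hlim
    exact tendsto_nhds_unique hlim tendsto_const_nhds
  · intro z hz
    have hmap : Continuous fun M : Matrix (Fin n) (Fin n) ℝ => M.map ((↑) : ℝ → ℂ) :=
      continuous_id.matrix_map Complex.continuous_ofReal
    -- The approximating matrices are `Ac (X k) - Gc (X k) * X (k + 1)`, stable by construction of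
    -- the iteration.
    exact Matrix.re_le_zero_of_mem_spectrum_of_tendsto (fun k => (hX k).2.2)
      ((hmap.tendsto _).comp (hA.sub (hG.mul hP1))) hz
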